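/- Let $S$ be a normal affine surface over $\mathbb{C}$, that is, $S=\mathrm{Spec}(R)$ where $R$ is a finitely generated $\mathbb{C}$-algebra which is an integrally closed domain of Krull dimension $2$. Let $\mathbf{x}\in S$ be a closed point at which $S$ is regular, and let $S_*:=S\setminus\{\mathbf{x}\}$. Let $\pi\colon P\to S_*$ be a principal $\mathbb{G}_a$-bundle, that is, a scheme $P$ over $S_*$ with an action of the additive group $\mathbb{G}_a$ for which $\pi$ is invariant, such that $S_*$ is covered by open subsets $U$ for which there is a $\mathbb{G}_a$-equivariant isomorphism $\pi^{-1}(U)\simeq U\times\mathbb{G}_a$ over $U$ ($\mathbb{G}_a$ acting on $U\times\mathbb{G}_a$ by translation on the second factor). Then the total space $P$ is affine if and only if the bundle is nontrivial, i.e. if and only if there is no $\mathbb{G}_a$-equivariant isomorphism $P\simeq S_*\times\mathbb{G}_a$ over $S_*$. -/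

import Mathlib

open CategoryTheory AlgebraicGeometry

universe u

/-- A (right) action of the additive group `G_a` on a scheme `X`: a morphism `X × G_a ⟶ X` which
satisfies the axioms of an action. The product `X × G_a` is the relative affine line
`𝔸(PUnit; X)`, and the axioms are stated on `T`-valued points: such a point of `X × G_a` is a pair
`(t, f)` of a point `t : T ⟶ X` and a function `f ∈ Γ(T, ⊤) = G_a(T)`, and the composite
`AffineSpace.homOfVector t (fun _ ↦ f) ≫ act` is the point `t · f` of `X`.
If `X` is a `ℂ`-scheme then `𝔸(PUnit; X)` is also the product of `X` and the complex group `G_a`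
over `ℂ`. -/
structure GaAction (X : Scheme.{u}) where
  act : 𝔸(PUnit.{u + 1}; X) ⟶ X
  act_zero : ∀ {T : Scheme.{u}} (t : T ⟶ X), AffineSpace.homOfVector t (fun _ ↦ 0) ≫ act = t
  act_add : ∀ {T : Scheme.{u}} (t : T ⟶ X) (f g : Γ(T, ⊤)),
    AffineSpace.homOfVector (AffineSpace.homOfVector t (fun _ ↦ f) ≫ act) (fun _ ↦ g) ≫ act =
      AffineSpace.homOfVector t (fun _ ↦ f + g) ≫ act

namespace GaAction

/-- A morphism `φ : X ⟶ Y` is `G_a`-equivariant: `φ(x · a) = φ(x) · a`. -/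
def IsEquivariant {X Y : Scheme.{u}} (α : GaAction X) (β : GaAction Y) (φ : X ⟶ Y) : Prop :=
  α.act ≫ φ = AffineSpace.map PUnit.{u + 1} φ ≫ β.act

/-- The morphism `(B × G_a) × G_a ⟶ B × G_a`, `((b, s), a) ↦ (b, s + a)`. -/
noncomputable def translationHom (B : Scheme.{u}) :
    𝔸(PUnit.{u + 1}; 𝔸(PUnit.{u + 1}; B)) ⟶ 𝔸(PUnit.{u + 1}; B) :=
  AffineSpace.homOfVector
    (𝔸(PUnit.{u + 1}; 𝔸(PUnit.{u + 1}; B)) ↘ 𝔸(PUnit.{u + 1}; B) ≫ 𝔸(PUnit.{u + 1}; B) ↘ B)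
    (fun i ↦ (𝔸(PUnit.{u + 1}; 𝔸(PUnit.{u + 1}; B)) ↘ 𝔸(PUnit.{u + 1}; B)).appTop
        (AffineSpace.coord B i) + AffineSpace.coord 𝔸(PUnit.{u + 1}; B) i)

theorem homOfVector_translationHom {B T : Scheme.{u}} (t : T ⟶ 𝔸(PUnit.{u + 1}; B))
    (v : PUnit.{u + 1} → Γ(T, ⊤)) :
    AffineSpace.homOfVector t v ≫ translationHom B =
      AffineSpace.homOfVector (t ≫ 𝔸(PUnit.{u + 1}; B) ↘ B)
        (fun i ↦ t.appTop (AffineSpace.coord B i) + v i) := by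
  rw [translationHom, AffineSpace.comp_homOfVector]
  congr 1
  · rw [AffineSpace.homOfVector_over_assoc]
  · funext i
    simp only [Function.comp_apply, map_add, AffineSpace.homOfVector_appTop_coord]
    congr 1
    rw [← CategoryTheory.comp_apply, ← Scheme.Hom.comp_appTop, AffineSpace.homOfVector_over]

/-- The action of `G_a` on `B × G_a` by translation on the second factor,
`(b, s) · a = (b, s + a)`. -/
noncomputable def translation (B : Scheme.{u}) : GaAction 𝔸(PUnit.{u + 1}; B) where
  act := translationHom B
  act_zero t := by
    rw [homOfVector_translationHom]
    apply AffineSpace.hom_ext <;> simp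
  act_add t f g := by
    simp only [homOfVector_translationHom]
    apply AffineSpace.hom_ext
    · simp
    · intro i
      simp [add_assoc]

end GaAction

/-- A principal `G_a`-bundle over a scheme `B`: a scheme `P` over `B` together with a fibrewise
action of `G_a` on `P`, such that every point of `B` has an open neighbourhood `U` over which
there is a `G_a`-equivariant isomorphism `U × G_a ≅ π⁻¹(U)` over `U`. -/
structure PrincipalGaBundle (B : Scheme.{u}) where
  total : Scheme.{u}
  proj : total ⟶ B
  action : GaAction total
  act_proj : action.act ≫ proj = (𝔸(PUnit.{u + 1}; total) ↘ total) ≫ proj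
  locally_trivial : ∀ b : B, ∃ U : B.Opens, b ∈ U ∧
    ∃ e : 𝔸(PUnit.{u + 1}; (U : Scheme.{u})) ≅ ((proj ⁻¹ᵁ U : total.Opens) : Scheme.{u}),
      e.hom ≫ (proj ∣_ U) = 𝔸(PUnit.{u + 1}; (U : Scheme.{u})) ↘ (U : Scheme.{u}) ∧
      (GaAction.translation (U : Scheme.{u})).IsEquivariant action
        (e.hom ≫ (proj ⁻¹ᵁ U).ι)

/-- A principal `G_a`-bundle over `B` is trivial if it is isomorphic, equivariantly and over `B`,
to `B × G_a` with the translation action. -/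
def PrincipalGaBundle.IsTrivial {B : Scheme.{u}} (P : PrincipalGaBundle B) : Prop :=
  ∃ e : 𝔸(PUnit.{u + 1}; B) ≅ P.total,
    e.hom ≫ P.proj = 𝔸(PUnit.{u + 1}; B) ↘ B ∧
    (GaAction.translation B).IsEquivariant P.action e.hom

/-- The open complement of a closed point `x` of `Spec R`. -/
def puncturedSpec (R : Type u) [CommRing R] (x : PrimeSpectrum R)
    (hx : IsClosed ({x} : Set (PrimeSpectrum R))) : (Spec (CommRingCat.of R)).Opens :=
  ⟨({x} : Set (PrimeSpectrum R))ᶜ, hx.isOpen_compl⟩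

/-! Let m be the maximal ideal of the point. Since P is affine over S_* and the D(a), a ∈ m, cover
S_*, P is affine exactly when m generates the unit ideal of Γ(P). If P is also trivial, a section
pulls this back to Γ(S_*), which is R by Hartogs, so m = R: a contradiction.

For the converse, consider functions F on P with F(p·a) = F(p) + ra; the slopes r ∈ R form an ideal
J, morally the annihilator of the class of P in H¹(S_*, O). A function of slope 1 trivializes P, and
local triviality forces every prime containing J to contain m. So if P is nontrivial there is r ∉ J
with mr ⊆ J. Regularity gives u, v ∈ m and s ∉ m with sm ⊆ (u, v). Choose f, g of slopes ur, vr.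
Then vf − ug is invariant, hence is some w ∈ R by descent and Hartogs.

If w ∉ m, the equation vf − ug = w puts a unit modulo m into mΓ(P), and P is affine. If w ∈ m, write
sw = αu + βv; then v(sf − β) = u(sg + α), so s(sf − β) is divisible by u, with a quotient of slope
s²r. As s² is invertible modulo m and mr ⊆ J, this gives r ∈ J, a contradiction. -/

/-! ### Commutative algebra: heights, parameters at a regular point, Hartogs -/

theorem MvPolynomial.height_eq_of_isMaximal (k : Type*) [Field k] (s : ℕ) :
    ∀ (n : Ideal (MvPolynomial (Fin s) k)) [n.IsMaximal], n.height = s := by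
  induction s with
  | zero =>
    intro n _
    have h : ringKrullDim (MvPolynomial (Fin 0) k) = 0 := by
      rw [MvPolynomial.ringKrullDim_of_isNoetherianRing]; simp
    have := Ideal.height_le_ringKrullDim_of_ne_top (I := n) Ideal.IsPrime.ne_top'
    rw [h] at this
    have h2 : n.height ≤ 0 := by exact_mod_cast this
    simpa using h2
  | succ s ih =>
    intro n _
    let e := (MvPolynomial.finSuccEquiv k s).toRingEquiv
    have : (n.map e).IsMaximal := Ideal.map_isMaximal_of_equiv e
    rw [← e.height_map n]
    -- The base is a Jacobson ring, so maximal ideals contract to maximal ideals, and each new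
    -- variable adds one to the height.
    have hM : ((n.map e).comap (Polynomial.C)).IsMaximal :=
      Polynomial.isMaximal_comap_C_of_isJacobsonRing _
    have : (n.map e).LiesOver ((n.map e).comap Polynomial.C) := ⟨rfl⟩
    rw [Polynomial.height_eq_height_add_one ((n.map e).comap Polynomial.C), ih]
    simp

/-- Finitely generated domains over a field are equidimensional. -/
theorem Ideal.ringKrullDim_le_height_of_isMaximal (k : Type*) {R : Type*} [Field k] [CommRing R]
    [IsDomain R] [Algebra k R] [Algebra.FiniteType k R] (M : Ideal R) [M.IsMaximal] :
    ringKrullDim R ≤ M.height := by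
  obtain ⟨s, g, hg, hint⟩ := exists_integral_inj_algHom_of_fg k R
  have := Algebra.FiniteType.isNoetherianRing k R
  algebraize [g.toRingHom]
  have : Algebra.IsIntegral (MvPolynomial (Fin s) k) R := ⟨hint⟩
  have : FaithfulSMul (MvPolynomial (Fin s) k) R := (faithfulSMul_iff_algebraMap_injective _ _).2 hg
  have hdim : ringKrullDim R ≤ s := by
    have : ringKrullDim R ≤ ringKrullDim (MvPolynomial (Fin s) k) := by
      refine Order.krullDim_le_of_strictMono
        (PrimeSpectrum.comap (algebraMap (MvPolynomial (Fin s) k) R)) ?_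
      intro p q h
      exact Ideal.IsIntegral.comap_lt_comap (I := p.asIdeal) (J := q.asIdeal) h
    refine this.trans ?_
    rw [MvPolynomial.ringKrullDim_of_isNoetherianRing]; simp
  let m := M.under (MvPolynomial (Fin s) k)
  have : m.IsMaximal := Ideal.isMaximal_comap_of_isIntegral_of_isMaximal M
  -- Going down over the polynomial ring of a Noether normalization: `M` is at least as high as its
  -- contraction, which has height `s`.
  have h := Ideal.height_eq_height_add_of_liesOver_of_hasGoingDown m M
  rw [MvPolynomial.height_eq_of_isMaximal k s m] at h
  refine hdim.trans ?_
  rw [h]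
  exact_mod_cast le_self_add

/-- The nonzero module R/I has an associated prime, the annihilator of the class of some r. It
contains I, hence m. -/
theorem Ideal.exists_notMem_forall_mul_mem {R : Type*} [CommRing R] [IsNoetherianRing R]
    {I m : Ideal R} (hI : I ≠ ⊤) (h : ∀ p : Ideal R, p.IsPrime → I ≤ p → m ≤ p) :
    ∃ r ∉ I, ∀ a ∈ m, a * r ∈ I := by
  have : Nontrivial (R ⧸ I) := Ideal.Quotient.nontrivial_iff.2 hI
  obtain ⟨p, hp⟩ := associatedPrimes.nonempty R (R ⧸ I)
  obtain ⟨hp', x, rfl⟩ := isAssociatedPrime_iff.1 hp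
  obtain ⟨r, rfl⟩ := Ideal.Quotient.mk_surjective x
  have hmem (a : R) : a ∈ (⊥ : Submodule R (R ⧸ I)).colon {Ideal.Quotient.mk I r} ↔ a * r ∈ I := by
    rw [Submodule.mem_colon_singleton, Submodule.mem_bot, ← Ideal.Quotient.eq_zero_iff_mem,
      map_mul, Algebra.smul_def]
    rfl
  refine ⟨r, fun hr ↦ hp'.ne_top ?_, fun a ha ↦ (hmem a).1 (h _ hp' ?_ ha)⟩
  · rw [Ideal.eq_top_iff_one, hmem, one_mul]
    exact hr
  · intro b hb
    exact (hmem b).2 (Ideal.mul_mem_right _ _ hb)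

/-- Two generators of the maximal ideal of the local ring can be replaced by elements of m; one
denominator s serves finitely many generators of m. If u were 0, m would be minimal over (v),
against Krull's principal ideal theorem. -/
theorem Ideal.exists_span_pair_of_regular {R : Type*} [CommRing R] [IsNoetherianRing R]
    (m : Ideal R) [m.IsPrime] (hreg : IsRegularLocalRing (Localization.AtPrime m))
    (hm : m.height = 2) :
    ∃ u ∈ m, u ≠ 0 ∧ ∃ v ∈ m, ∃ s ∉ m, ∀ a ∈ m, ∃ p q, s * a = p * u + q * v := by
  classical
  let L := Localization.AtPrime m
  have h2 : (IsLocalRing.maximalIdeal L).spanFinrank = 2 := by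
    have := hreg.spanFinrank_maximalIdeal
    rw [IsLocalization.AtPrime.ringKrullDim_eq_height m L, hm] at this
    exact_mod_cast this
  have hfg := (IsLocalRing.maximalIdeal L).fg_of_isNoetherianRing
  have hc := Submodule.FG.generators_ncard hfg
  rw [h2, Set.ncard_eq_two] at hc
  obtain ⟨x, y, -, hxy⟩ := hc
  have hsp : Ideal.span {x, y} = IsLocalRing.maximalIdeal L := by
    rw [← hxy]; exact Submodule.span_generators _
  have key (x : L) (hx : x ∈ IsLocalRing.maximalIdeal L) :
      ∃ u ∈ m, ∃ c : L, x = c * algebraMap R L u := by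
    obtain ⟨u, s, rfl⟩ := IsLocalization.exists_mk'_eq m.primeCompl x
    refine ⟨u, ?_, IsLocalization.mk' L 1 s, ?_⟩
    · by_contra hu
      have := (IsLocalization.AtPrime.isUnit_mk'_iff L m u s).2 hu
      exact (IsLocalRing.mem_maximalIdeal _).1 hx this
    · rw [mul_comm, IsLocalization.mul_mk'_eq_mk'_of_mul, mul_one]
  obtain ⟨u, hu, c, hc⟩ := key x (hsp ▸ Ideal.subset_span (by simp))
  obtain ⟨v, hv, d, hd⟩ := key y (hsp ▸ Ideal.subset_span (by simp))
  have h1 (a : R) (ha : a ∈ m) : ∃ s ∉ m, s * a ∈ Ideal.span {u, v} := by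
    have h3 : algebraMap R L a ∈ (Ideal.span {u, v}).map (algebraMap R L) := by
      have : algebraMap R L a ∈ IsLocalRing.maximalIdeal L :=
        (IsLocalization.AtPrime.to_map_mem_maximal_iff L m a).2 ha
      rw [← hsp] at this
      refine (Ideal.span_le.2 ?_) this
      rintro z (rfl | rfl)
      · rw [hc]; exact Ideal.mul_mem_left _ _ (Ideal.mem_map_of_mem _ (Ideal.subset_span (by simp)))
      · rw [hd]; exact Ideal.mul_mem_left _ _ (Ideal.mem_map_of_mem _ (Ideal.subset_span (by simp)))
    obtain ⟨s, hs, h⟩ := (IsLocalization.algebraMap_mem_map_algebraMap_iff m.primeCompl L _ _).1 h3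
    exact ⟨s, hs, h⟩
  obtain ⟨t, ht⟩ := (inferInstance : IsNoetherian R R).noetherian m
  have h4 : ∃ s ∉ m, ∀ a ∈ t, s * a ∈ Ideal.span {u, v} := by
    have hm' : ∀ a ∈ t, a ∈ m := fun a ha ↦ ht ▸ Ideal.subset_span ha
    clear ht
    induction t using Finset.induction_on with
    | empty => exact ⟨1, fun h ↦ Ideal.IsPrime.ne_top' ((Ideal.eq_top_iff_one m).2 h), by simp⟩
    | insert a t _ ih =>
      obtain ⟨s, hs, h⟩ := ih fun b hb ↦ hm' b (Finset.mem_insert_of_mem hb)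
      obtain ⟨s', hs', h'⟩ := h1 a (hm' a (Finset.mem_insert_self _ _))
      refine ⟨s * s', fun h ↦ (Ideal.IsPrime.mem_or_mem ‹_› h).elim hs hs', fun b hb ↦ ?_⟩
      rcases Finset.mem_insert.1 hb with rfl | hb
      · rw [mul_assoc]; exact Ideal.mul_mem_left _ _ h'
      · rw [mul_comm s, mul_assoc]; exact Ideal.mul_mem_left _ _ (h b hb)
  obtain ⟨s, hs, h⟩ := h4
  have h5 (a : R) (ha : a ∈ m) : s * a ∈ Ideal.span {u, v} := by
    have hle : m ≤ Submodule.comap (LinearMap.mulLeft R s) (Ideal.span {u, v}) := by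
      rw [← ht]; exact Submodule.span_le.2 h
    exact hle ha
  have h6 (a : R) (ha : a ∈ m) : ∃ p q, s * a = p * u + q * v := by
    obtain ⟨p, q, h⟩ := Ideal.mem_span_pair.1 (h5 a ha)
    exact ⟨p, q, h.symm⟩
  refine ⟨u, hu, ?_, v, hv, s, hs, h6⟩
  rintro rfl
  have hmin : m ∈ (Ideal.span {v}).minimalPrimes := by
    refine ⟨⟨inferInstance, (Ideal.span_singleton_le_iff_mem _).2 hv⟩, ?_⟩
    rintro p ⟨hp, hvp⟩ hpm a ha
    obtain ⟨b, c, h⟩ := h6 a ha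
    rw [mul_zero, zero_add] at h
    have hsa : s * a ∈ p := h ▸ Ideal.mul_mem_left _ _ (hvp (Ideal.mem_span_singleton_self v))
    exact (hp.mem_or_mem hsa).resolve_left fun h ↦ hs (hpm h)
  have h7 := Ideal.height_le_one_of_isPrincipal_of_mem_minimalPrimes (Ideal.span {v}) m hmin
  rw [hm] at h7
  exact absurd h7 (by decide)

/-- Hartogs' theorem for a closed point of codimension at least two of a normal noetherian
scheme. -/
theorem IsIntegrallyClosed.mem_range_of_forall_pow_mul_mem_range {R A : Type*} [CommRing R]
    [IsDomain R] [IsIntegrallyClosed R] [IsNoetherianRing R] [CommRing A] [IsDomain A] [Algebra R A]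
    (hinj : Function.Injective (algebraMap R A)) (m : Ideal R) (hm : m.IsMaximal)
    (hht : 2 ≤ m.height) (f : A)
    (hf : ∀ a ∈ m, ∃ n : ℕ, ∃ r, algebraMap R A a ^ n * f = algebraMap R A r) :
    ∃ r, f = algebraMap R A r := by
  -- The denominators of `f`. Every element of m has a power in `I`, so if `I` is proper some `r ∉
  -- I` has `m r ⊆ I`, and `z = r f` multiplies m into R.
  let I : Ideal R :=
    { carrier := {d | ∃ r, algebraMap R A d * f = algebraMap R A r}
      add_mem' := by
        rintro a b ⟨r, hr⟩ ⟨s, hs⟩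
        exact ⟨r + s, by rw [map_add, add_mul, hr, hs, map_add]⟩
      zero_mem' := ⟨0, by simp⟩
      smul_mem' := by
        rintro c a ⟨r, hr⟩
        exact ⟨c * r, by rw [smul_eq_mul, map_mul, mul_assoc, hr, map_mul]⟩ }
  by_cases hI : I = ⊤
  · obtain ⟨r, hr⟩ : (1 : R) ∈ I := hI ▸ Submodule.mem_top
    exact ⟨r, by simpa using hr⟩
  exfalso
  obtain ⟨r, hr, hmr⟩ := Ideal.exists_notMem_forall_mul_mem (m := m) hI (fun p hp hIp a ha ↦ by
    obtain ⟨n, r, h⟩ := hf a ha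
    exact hp.mem_of_pow_mem n (hIp ⟨r, by rw [map_pow, h]⟩))
  set z := algebraMap R A r * f with hz
  have hmz (a : R) (ha : a ∈ m) : ∃ c, algebraMap R A a * z = algebraMap R A c := by
    obtain ⟨c, hc⟩ := hmr a ha
    exact ⟨c, by rw [← hc, map_mul, hz, mul_assoc]⟩
  have hm0 : m ≠ ⊥ := by
    rintro rfl
    simp at hht
  -- If z maps m into itself, z is integral over R by the determinant trick. It is also the fraction
  -- c/b, so normality puts it in R.
  by_cases hcase : ∀ a ∈ m, ∃ c ∈ m, algebraMap R A a * z = algebraMap R A c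
  · obtain ⟨b, hb, hb0⟩ := Submodule.exists_mem_ne_zero_of_ne_bot hm0
    obtain ⟨c, hc⟩ := hmz b hb
    have hint : IsIntegral R z := by
      refine isIntegral_of_smul_mem_submodule (M := A) (Submodule.map (Algebra.linearMap R A) m) ?_ ?_ z ?_
      · intro h
        apply hb0
        have hmem : algebraMap R A b ∈ Submodule.map (Algebra.linearMap R A) m := ⟨b, hb, rfl⟩
        rw [h, Submodule.mem_bot] at hmem
        exact (map_eq_zero_iff _ hinj).1 hmem
      · exact Submodule.FG.map _ m.fg_of_isNoetherianRing
      · rintro _ ⟨a, ha, rfl⟩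
        obtain ⟨c, hc, h⟩ := hcase a ha
        exact ⟨c, hc, by simp [← h, mul_comm]⟩
    let K := FractionRing R
    let L := FractionRing A
    have : FaithfulSMul R L := (faithfulSMul_iff_algebraMap_injective _ _).2 (by
      rw [IsScalarTower.algebraMap_eq R A L]
      exact (IsFractionRing.injective A L).comp hinj)
    let : Algebra K L := FractionRing.liftAlgebra R L
    have hbL : algebraMap R L b ≠ 0 := by
      simpa using hb0
    have hbK : algebraMap R K b ≠ 0 := by simpa using hb0
    have hzL : algebraMap A L z = algebraMap K L (algebraMap R K c / algebraMap R K b) := by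
      rw [map_div₀, ← IsScalarTower.algebraMap_apply, ← IsScalarTower.algebraMap_apply,
        eq_div_iff hbL, IsScalarTower.algebraMap_apply R A L, IsScalarTower.algebraMap_apply R A L,
        ← map_mul, ← hc, mul_comm]
    have hK : IsIntegral R (algebraMap R K c / algebraMap R K b) := by
      have h1 : IsIntegral R (algebraMap A L z) := hint.algebraMap
      rw [hzL] at h1
      exact (isIntegral_algebraMap_iff (algebraMap K L).injective).1 h1
    obtain ⟨y, hy⟩ := IsIntegrallyClosed.isIntegral_iff.1 hK
    apply hr
    refine ⟨y, IsFractionRing.injective A L ?_⟩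
    rw [← hz, hzL, ← hy, ← IsScalarTower.algebraMap_apply, ← IsScalarTower.algebraMap_apply]
  -- Here `a z = c` is a unit modulo m. From `c b = d a` for all b ∈ m, m is minimal over (a), so
  -- its height is at most one.
  · push Not at hcase
    obtain ⟨a, ha, h⟩ := hcase
    obtain ⟨c, hc⟩ := hmz a ha
    have hcm : c ∉ m := fun hcm ↦ h c hcm hc
    have hmin : m ∈ (Ideal.span {a}).minimalPrimes := by
      refine ⟨⟨hm.isPrime, (Ideal.span_singleton_le_iff_mem _).2 ha⟩, ?_⟩
      rintro p ⟨hp, hap⟩ hpm b hb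
      obtain ⟨d, hd⟩ := hmz b hb
      have : c * b = d * a := hinj (by
        rw [map_mul, map_mul, ← hc, ← hd]; ring)
      have hcb : c * b ∈ p := by
        rw [this]
        exact Ideal.mul_mem_left _ _ (hap (Ideal.mem_span_singleton_self a))
      exact (hp.mem_or_mem hcb).resolve_left fun h ↦ hcm (hpm h)
    have := hm.isPrime
    have h1 := Ideal.height_le_one_of_isPrincipal_of_mem_minimalPrimes (Ideal.span {a}) m hmin
    exact absurd (hht.trans h1) (by decide)

/-! ### Gluing, functions on basic opens, and flatness over a domain -/

namespace AlgebraicGeometry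

theorem Scheme.Hom.comp_appTop_apply {X Y Z : Scheme.{u}} (f : X ⟶ Y) (g : Y ⟶ Z) (s : Γ(Z, ⊤)) :
    (f ≫ g).appTop s = f.appTop (g.appTop s) := by
  rw [Scheme.Hom.comp_appTop, CommRingCat.comp_apply]

/-- The uniqueness clause on T-valued points makes the local section g a two-sided inverse of f over
V. -/
theorem Scheme.isIso_of_forall_exists_opens {X Y : Scheme.{u}} (f : X ⟶ Y)
    (h : ∀ y : Y, ∃ V : Y.Opens, y ∈ V ∧ ∃ g : (V : Scheme.{u}) ⟶ X, g ≫ f = V.ι ∧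
      ∀ {T : Scheme.{u}} (p : T ⟶ X) (q : T ⟶ (V : Scheme.{u})), p ≫ f = q ≫ V.ι → p = q ≫ g) :
    IsIso f := by
  change MorphismProperty.isomorphisms Scheme.{u} f
  refine IsZariskiLocalAtTarget.of_forall_exists_morphismRestrict fun y ↦ ?_
  obtain ⟨V, hy, g, hg, hu⟩ := h y
  refine ⟨V, hy, ?_⟩
  have hr : Set.range g ⊆ Set.range (f ⁻¹ᵁ V).ι := by
    rw [Scheme.Opens.range_ι]
    rintro _ ⟨z, rfl⟩
    change f (g z) ∈ V
    rw [← Scheme.Hom.comp_apply, hg]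
    exact z.2
  have hl := IsOpenImmersion.lift_fac (f ⁻¹ᵁ V).ι g hr
  refine ⟨IsOpenImmersion.lift (f ⁻¹ᵁ V).ι g hr, ?_, ?_⟩
  · rw [← cancel_mono (f ⁻¹ᵁ V).ι, Category.assoc, hl, Category.id_comp]
    exact (hu _ _ (morphismRestrict_ι f V).symm).symm
  · rw [← cancel_mono V.ι, Category.assoc, morphismRestrict_ι, ← Category.assoc, hl, hg,
      Category.id_comp]

theorem Scheme.appTop_ext {X : Scheme.{u}} {ι : Type u} {U : ι → X.Opens}
    (hU : TopologicalSpace.IsOpenCover U) {s t : Γ(X, ⊤)}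
    (h : ∀ i, (U i).ι.appTop s = (U i).ι.appTop t) : s = t := by
  -- Functions are treated as sections of the affine line, so that locality follows from that of
  -- morphisms.
  have : AffineSpace.homOfVector (n := PUnit.{u + 1}) (𝟙 X) (fun _ ↦ s) =
      AffineSpace.homOfVector (𝟙 X) (fun _ ↦ t) := by
    refine Scheme.Cover.hom_ext (X.openCoverOfIsOpenCover U hU) _ _ fun i ↦ ?_
    rw [AffineSpace.comp_homOfVector, AffineSpace.comp_homOfVector]
    congr 1
    funext _
    exact h i
  simpa [-TopologicalSpace.Opens.map_top, AffineSpace.homOfVector_appTop_coord] using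
    congr((Scheme.Hom.appTop $this) (AffineSpace.coord X PUnit.unit))

theorem Scheme.exists_appTop_eq {X : Scheme.{u}} {ι : Type u} {U : ι → X.Opens}
    (hU : TopologicalSpace.IsOpenCover U) (s : ∀ i, Γ((U i : Scheme.{u}), ⊤))
    (h : ∀ i j {T : Scheme.{u}} (p : T ⟶ (U i : Scheme.{u})) (q : T ⟶ (U j : Scheme.{u})),
      p ≫ (U i).ι = q ≫ (U j).ι → p.appTop (s i) = q.appTop (s j)) :
    ∃ t : Γ(X, ⊤), ∀ i, (U i).ι.appTop t = s i := by
  let ψ (i : ι) : (U i : Scheme.{u}) ⟶ 𝔸(PUnit.{u + 1}; X) :=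
    AffineSpace.homOfVector (U i).ι (fun _ ↦ s i)
  have hψ (i j : ι) {T : Scheme.{u}} (p : T ⟶ (U i : Scheme.{u})) (q : T ⟶ (U j : Scheme.{u}))
      (hpq : p ≫ (U i).ι = q ≫ (U j).ι) : p ≫ ψ i = q ≫ ψ j := by
    rw [AffineSpace.comp_homOfVector, AffineSpace.comp_homOfVector, hpq]
    congr 1
    funext _
    exact h i j p q hpq
  let φ : X ⟶ 𝔸(PUnit.{u + 1}; X) := (X.openCoverOfIsOpenCover U hU).glueMorphisms ψ
    fun i j ↦ hψ i j _ _ Limits.pullback.condition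
  refine ⟨φ.appTop (AffineSpace.coord X PUnit.unit), fun i ↦ ?_⟩
  have hi : (U i).ι ≫ φ = ψ i :=
    Scheme.Cover.ι_glueMorphisms (X.openCoverOfIsOpenCover U hU) _ _ i
  rw [← Scheme.Hom.comp_appTop_apply, hi, AffineSpace.homOfVector_appTop_coord]

theorem Scheme.Opens.ι_appTop_topIso_hom {X : Scheme.{u}} (U : X.Opens) :
    U.ι.appTop ≫ U.topIso.hom = X.presheaf.map (homOfLE le_top).op := by
  simp only [Scheme.Opens.ι_appTop, topIso_hom]
  exact (Functor.map_comp _ _ _).symm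

theorem Scheme.exists_pow_mul_eq_zero_of_appTop_basicOpen_ι_eq_zero {X : Scheme.{u}}
    [CompactSpace X] (a s : Γ(X, ⊤)) (h : (X.basicOpen a).ι.appTop s = 0) :
    ∃ n : ℕ, a ^ n * s = 0 := by
  refine exists_pow_mul_eq_zero_of_res_basicOpen_eq_zero_of_isCompact X
    (U := ⊤) CompactSpace.isCompact_univ s a ?_
  have h' := congr((X.basicOpen a).topIso.hom $h)
  rw [map_zero, ← CommRingCat.comp_apply, Scheme.Opens.ι_appTop_topIso_hom] at h'
  exact h'

theorem Scheme.exists_appTop_basicOpen_ι_eq_pow_mul {X : Scheme.{u}} [CompactSpace X]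
    [QuasiSeparatedSpace X] (a : Γ(X, ⊤)) (t : Γ((X.basicOpen a : Scheme.{u}), ⊤)) :
    ∃ (n : ℕ) (s : Γ(X, ⊤)), (X.basicOpen a).ι.appTop s = (X.basicOpen a).ι.appTop a ^ n * t := by
  obtain ⟨n, y, hy⟩ := exists_eq_pow_mul_of_isCompact_of_isQuasiSeparated X ⊤
    CompactSpace.isCompact_univ isQuasiSeparated_univ a ((X.basicOpen a).topIso.hom t)
  refine ⟨n, y, ?_⟩
  have hres (z : Γ(X, ⊤)) : (X.basicOpen a).topIso.hom ((X.basicOpen a).ι.appTop z) =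
      z |_ X.basicOpen a := by
    rw [← CommRingCat.comp_apply, Scheme.Opens.ι_appTop_topIso_hom]
    rfl
  apply (ConcreteCategory.bijective_of_isIso (X.basicOpen a).topIso.hom).1
  rw [map_mul, map_pow, hres, hres, hy]

/-- The pullback of functions along a morphism to `Spec R`. -/
noncomputable def Scheme.scalar {R : Type u} [CommRing R] {X : Scheme.{u}}
    (q : X ⟶ Spec (CommRingCat.of R)) : R →+* Γ(X, ⊤) :=
  ((Scheme.ΓSpecIso (CommRingCat.of R)).inv ≫ q.appTop).hom

theorem Scheme.scalar_comp {R : Type u} [CommRing R] {X Y : Scheme.{u}} (f : X ⟶ Y)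
    (q : Y ⟶ Spec (CommRingCat.of R)) (r : R) :
    Scheme.scalar (f ≫ q) r = f.appTop (Scheme.scalar q r) := by
  rw [Scheme.scalar, Scheme.Hom.comp_appTop, ← Category.assoc, CommRingCat.hom_comp]
  rfl

theorem Scheme.mem_basicOpen_scalar_iff {R : Type u} [CommRing R] {X : Scheme.{u}}
    (q : X ⟶ Spec (CommRingCat.of R)) (r : R) (y : X) :
    y ∈ X.basicOpen (Scheme.scalar q r) ↔ r ∉ (q y).asIdeal := by
  have : X.basicOpen (Scheme.scalar q r) = q ⁻¹ᵁ (PrimeSpectrum.basicOpen r) := by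
    have h1 : Scheme.scalar q r =
        q.appTop ((Scheme.ΓSpecIso (CommRingCat.of R)).inv r) := by
      rw [Scheme.scalar, CommRingCat.hom_comp]
      rfl
    rw [h1, ← Scheme.preimage_basicOpen_top, basicOpen_eq_of_affine]
  rw [this]
  rfl

theorem AffineSpace.flat_over (n : Type u) (S : Scheme.{u}) : Flat (𝔸(n; S) ↘ S) := by
  refine MorphismProperty.IsStableUnderBaseChange.of_isPullback (P := @Flat.{u})
    (IsPullback.of_hasPullback (Limits.terminal.from S) (Limits.terminal.from
      (Spec (CommRingCat.of (MvPolynomial n (ULift.{u} ℤ)))))).flip ?_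
  have := Limits.isIso_of_isTerminal specULiftZIsTerminal.{u} Limits.terminalIsTerminal
    (Limits.terminal.from _)
  rw [← Limits.terminal.comp_from (Spec.map (CommRingCat.ofHom MvPolynomial.C))]
  have : Flat (Spec.map (CommRingCat.ofHom (MvPolynomial.C (R := ULift.{u} ℤ) (σ := n)))) := by
    rw [Flat.SpecMap_iff]
    exact RingHom.flat_algebraMap_iff.2
      (inferInstance : Module.Flat (ULift.{u} ℤ) (MvPolynomial n (ULift.{u} ℤ)))
  infer_instance

/-- Flatness preserves nonzerodivisors. This permits cancelling scalars on P and P × G_a without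
integrality of either. -/
theorem Scheme.scalar_mul_eq_zero {R : Type u} [CommRing R] [IsDomain R] {X : Scheme.{u}}
    (q : X ⟶ Spec (CommRingCat.of R)) [Flat q] {r : R} (hr : r ≠ 0) {s : Γ(X, ⊤)}
    (h : Scheme.scalar q r * s = 0) : s = 0 := by
  refine Scheme.appTop_ext (iSup_affineOpens_eq_top X) fun i ↦ ?_
  have : IsAffine (i : X.Opens) := i.2
  have : Flat (i.1.ι ≫ q) := inferInstance
  have hfl : (Scheme.scalar (i.1.ι ≫ q)).Flat := by
    rw [Scheme.scalar, CommRingCat.hom_comp]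
    refine RingHom.Flat.comp (RingHom.Flat.of_bijective ?_) (Scheme.Hom.flat_appTop _)
    exact ConcreteCategory.bijective_of_isIso (Scheme.ΓSpecIso (CommRingCat.of R)).inv
  replace h := congr((i.1.ι).appTop $h)
  rw [map_mul, map_zero, ← Scheme.scalar_comp] at h
  rw [map_zero]
  let := (Scheme.scalar (i.1.ι ≫ q)).toAlgebra
  have : Module.Flat R Γ((i.1 : Scheme.{u}), ⊤) := hfl
  have hreg : IsSMulRegular Γ((i.1 : Scheme.{u}), ⊤) r :=
    Module.Flat.isSMulRegular_of_nonZeroDivisors (mem_nonZeroDivisors_of_ne_zero hr)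
  exact hreg.right_eq_zero_of_smul (by rw [Algebra.smul_def]; exact h)

end AlgebraicGeometry

/-! ### Actions on T-valued points and functions affine along orbits -/

namespace GaAction

variable {X Y : Scheme.{u}} (α : GaAction X) (β : GaAction Y)

/-- The action on `T`-valued points. -/
noncomputable def smul {T : Scheme.{u}} (p : T ⟶ X) (a : Γ(T, ⊤)) : T ⟶ X :=
  AffineSpace.homOfVector p (fun _ ↦ a) ≫ α.act

theorem comp_smul {S T : Scheme.{u}} (q : S ⟶ T) (p : T ⟶ X) (a : Γ(T, ⊤)) :
    q ≫ α.smul p a = α.smul (q ≫ p) (q.appTop a) := by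
  rw [smul, ← Category.assoc, AffineSpace.comp_homOfVector]
  rfl

theorem smul_add {T : Scheme.{u}} (p : T ⟶ X) (a b : Γ(T, ⊤)) :
    α.smul (α.smul p a) b = α.smul p (a + b) :=
  α.act_add p a b

theorem homOfVector_over_coord (X : Scheme.{u}) :
    AffineSpace.homOfVector (𝔸(PUnit.{u + 1}; X) ↘ X)
      (fun _ ↦ AffineSpace.coord X PUnit.unit) = 𝟙 _ := by
  apply AffineSpace.hom_ext
  · simp
  · intro i
    rw [AffineSpace.homOfVector_appTop_coord, Scheme.Hom.id_appTop]
    rfl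

theorem act_eq_smul :
    α.act = α.smul (𝔸(PUnit.{u + 1}; X) ↘ X) (AffineSpace.coord X PUnit.unit) := by
  rw [smul, homOfVector_over_coord, Category.id_comp]

theorem smul_translation {B T : Scheme.{u}} (p : T ⟶ 𝔸(PUnit.{u + 1}; B)) (a : Γ(T, ⊤)) :
    (translation B).smul p a = AffineSpace.homOfVector (p ≫ 𝔸(PUnit.{u + 1}; B) ↘ B)
      (fun i ↦ p.appTop (AffineSpace.coord B i) + a) :=
  homOfVector_translationHom p fun _ ↦ a

variable {α β} in
theorem IsEquivariant.smul_comp {φ : X ⟶ Y} (h : α.IsEquivariant β φ) {T : Scheme.{u}}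
    (p : T ⟶ X) (a : Γ(T, ⊤)) : α.smul p a ≫ φ = β.smul (p ≫ φ) a := by
  rw [smul, Category.assoc, h, smul, ← Category.assoc]
  congr 1
  apply AffineSpace.hom_ext
  · simp
  · intro i
    rw [Scheme.Hom.comp_appTop_apply, AffineSpace.map_appTop_coord,
      AffineSpace.homOfVector_appTop_coord, AffineSpace.homOfVector_appTop_coord]

/-- A function `F` with `F(p · a) = F(p) + s(p) a`. -/
def HasSlope (F s : Γ(X, ⊤)) : Prop :=
  ∀ ⦃T : Scheme.{u}⦄ (p : T ⟶ X) (a : Γ(T, ⊤)),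
    (α.smul p a).appTop F = p.appTop F + p.appTop s * a

/-- The identity need only be checked at the universal point of X × G_a. -/
theorem hasSlope_of_act {F s : Γ(X, ⊤)}
    (h : α.act.appTop F = (𝔸(PUnit.{u + 1}; X) ↘ X).appTop F +
      (𝔸(PUnit.{u + 1}; X) ↘ X).appTop s * AffineSpace.coord X PUnit.unit) :
    α.HasSlope F s := by
  intro T p a
  rw [smul, Scheme.Hom.comp_appTop_apply, h, map_add, map_mul,
    AffineSpace.homOfVector_appTop_coord, ← Scheme.Hom.comp_appTop_apply,
    ← Scheme.Hom.comp_appTop_apply, AffineSpace.homOfVector_over]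

variable {α} {F G s t k : Γ(X, ⊤)}

theorem HasSlope.act_appTop (h : α.HasSlope F s) :
    α.act.appTop F = (𝔸(PUnit.{u + 1}; X) ↘ X).appTop F +
      (𝔸(PUnit.{u + 1}; X) ↘ X).appTop s * AffineSpace.coord X PUnit.unit := by
  rw [act_eq_smul]
  exact h _ _

theorem HasSlope.add (hF : α.HasSlope F s) (hG : α.HasSlope G t) :
    α.HasSlope (F + G) (s + t) := by
  intro T p a
  rw [map_add, hF, hG, map_add, map_add]
  ring

theorem HasSlope.sub (hF : α.HasSlope F s) (hG : α.HasSlope G t) :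
    α.HasSlope (F - G) (s - t) := by
  intro T p a
  rw [map_sub, hF, hG, map_sub, map_sub]
  ring

theorem HasSlope.mul (hk : α.HasSlope k 0) (hF : α.HasSlope F s) :
    α.HasSlope (k * F) (k * s) := by
  intro T p a
  rw [map_mul, hF, hk, map_mul, map_mul, map_zero]
  ring

end GaAction

/-! ### Charts, descent of invariant functions, and triviality -/

namespace PrincipalGaBundle

open GaAction

variable {B : Scheme.{u}} (P : PrincipalGaBundle B)

theorem smul_proj {T : Scheme.{u}} (p : T ⟶ P.total) (a : Γ(T, ⊤)) :
    P.action.smul p a ≫ P.proj = p ≫ P.proj := by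
  rw [smul, Category.assoc, P.act_proj, ← Category.assoc, AffineSpace.homOfVector_over]

theorem hasSlope_proj_appTop (f : Γ(B, ⊤)) : P.action.HasSlope (P.proj.appTop f) 0 := by
  intro T p a
  rw [map_zero, zero_mul, add_zero, ← Scheme.Hom.comp_appTop_apply, smul_proj,
    Scheme.Hom.comp_appTop_apply]

/-- A local section of the bundle, with the coordinate of a point relative to the section. -/
structure Chart where
  U : B.Opens
  sec : (U : Scheme.{u}) ⟶ P.total
  sec_proj : sec ≫ P.proj = U.ι
  coord : Γ(((P.proj ⁻¹ᵁ U : P.total.Opens) : Scheme.{u}), ⊤)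
  smul_coord : P.action.smul ((P.proj ∣_ U) ≫ sec) coord = (P.proj ⁻¹ᵁ U).ι
  coord_smul : ∀ {T : Scheme.{u}} (q : T ⟶ (U : Scheme.{u})) (a : Γ(T, ⊤))
    (p : T ⟶ ((P.proj ⁻¹ᵁ U : P.total.Opens) : Scheme.{u})),
    p ≫ (P.proj ⁻¹ᵁ U).ι = P.action.smul (q ≫ sec) a → p.appTop coord = a

/-- The section is the zero section of U × G_a carried over by the local trivialization, and the
coordinate is that of the inverse. -/
theorem exists_chart (b : B) : ∃ C : P.Chart, b ∈ C.U := by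
  obtain ⟨U, hb, e, he, heq⟩ := P.locally_trivial b
  let σ₀ : (U : Scheme.{u}) ⟶ 𝔸(PUnit.{u + 1}; (U : Scheme.{u})) :=
    AffineSpace.homOfVector (𝟙 _) (fun _ ↦ 0)
  have key {T : Scheme.{u}} (q : T ⟶ (U : Scheme.{u})) (a : Γ(T, ⊤)) :
      P.action.smul (q ≫ σ₀ ≫ e.hom ≫ (P.proj ⁻¹ᵁ U).ι) a =
        AffineSpace.homOfVector q (fun _ ↦ a) ≫ e.hom ≫ (P.proj ⁻¹ᵁ U).ι := by
    rw [← Category.assoc, ← heq.smul_comp, smul_translation]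
    congr 2
    · simp [σ₀]
    · funext i
      rw [Scheme.Hom.comp_appTop_apply, AffineSpace.homOfVector_appTop_coord, map_zero, zero_add]
  have hinv : AffineSpace.homOfVector (P.proj ∣_ U) (fun i ↦ e.inv.appTop
      (AffineSpace.coord (U : Scheme.{u}) i)) = e.inv := by
    apply AffineSpace.hom_ext
    · rw [AffineSpace.homOfVector_over, ← he, Iso.inv_hom_id_assoc]
    · intro i
      rw [AffineSpace.homOfVector_appTop_coord]
  refine ⟨⟨U, σ₀ ≫ e.hom ≫ (P.proj ⁻¹ᵁ U).ι, ?_, e.inv.appTop (AffineSpace.coord _ PUnit.unit),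
    ?_, ?_⟩, hb⟩
  · rw [Category.assoc, Category.assoc, ← morphismRestrict_ι, ← Category.assoc e.hom, he]
    simp [σ₀]
  · rw [key]
    exact (congr($hinv ≫ _)).trans (by simp)
  · intro T q a p hp
    rw [key, ← Category.assoc, cancel_mono] at hp
    rw [hp, ← Scheme.Hom.comp_appTop_apply, Category.assoc, Iso.hom_inv_id, Category.comp_id,
      AffineSpace.homOfVector_appTop_coord]

variable {P}

theorem Chart.exists_eq_smul (C : P.Chart) {T : Scheme.{u}} (p : T ⟶ P.total)
    (q : T ⟶ (C.U : Scheme.{u})) (h : p ≫ P.proj = q ≫ C.U.ι) :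
    ∃ a, p = P.action.smul (q ≫ C.sec) a := by
  let p' : T ⟶ ((P.proj ⁻¹ᵁ C.U : P.total.Opens) : Scheme.{u}) :=
    IsOpenImmersion.lift (P.proj ⁻¹ᵁ C.U).ι p (by
      rw [Scheme.Opens.range_ι]
      rintro _ ⟨z, rfl⟩
      change P.proj (p z) ∈ C.U
      rw [← Scheme.Hom.comp_apply, h]
      exact (q z).2)
  have hp' : p' ≫ (P.proj ⁻¹ᵁ C.U).ι = p := IsOpenImmersion.lift_fac _ _ _
  refine ⟨p'.appTop C.coord, ?_⟩
  have hq : p' ≫ (P.proj ∣_ C.U) = q := by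
    rw [← cancel_mono C.U.ι, Category.assoc, morphismRestrict_ι, ← Category.assoc, hp', h]
  rw [← hq, Category.assoc, ← comp_smul, C.smul_coord, hp']

theorem Chart.appTop_coord_of_eq_smul (C : P.Chart) {T : Scheme.{u}}
    (p₁ p₂ : T ⟶ ((P.proj ⁻¹ᵁ C.U : P.total.Opens) : Scheme.{u})) (a : Γ(T, ⊤))
    (h : p₂ ≫ (P.proj ⁻¹ᵁ C.U).ι = P.action.smul (p₁ ≫ (P.proj ⁻¹ᵁ C.U).ι) a) :
    p₂.appTop C.coord = p₁.appTop C.coord + a := by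
  refine C.coord_smul (p₁ ≫ (P.proj ∣_ C.U)) _ _ ?_
  rw [h, ← C.smul_coord, comp_smul, smul_add, Category.assoc]

variable (P) in
theorem exists_chart_cover : ∃ C : B → P.Chart, TopologicalSpace.IsOpenCover fun b ↦ (C b).U := by
  choose C hC using P.exists_chart
  exact ⟨C, eq_top_iff.2 fun b _ ↦ TopologicalSpace.Opens.mem_iSup.2 ⟨b, hC b⟩⟩

/-- Invariant functions descend to the base. -/
theorem exists_proj_appTop_eq {F : Γ(P.total, ⊤)} (hF : P.action.HasSlope F 0) :
    ∃ f : Γ(B, ⊤), P.proj.appTop f = F := by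
  obtain ⟨C, hC⟩ := P.exists_chart_cover
  have hinv {T : Scheme.{u}} (p : T ⟶ P.total) (a) : (P.action.smul p a).appTop F = p.appTop F := by
    rw [hF, map_zero, zero_mul, add_zero]
  obtain ⟨f, hf⟩ := Scheme.exists_appTop_eq hC
    (fun b ↦ (C b).sec.appTop F) (by
      intro i j T p q hpq
      obtain ⟨a, ha⟩ := (C i).exists_eq_smul (q ≫ (C j).sec) p (by
        rw [Category.assoc, (C j).sec_proj, hpq])
      rw [← Scheme.Hom.comp_appTop_apply, ← Scheme.Hom.comp_appTop_apply, ha, hinv])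
  refine ⟨f, Scheme.appTop_ext (U := fun b ↦ P.proj ⁻¹ᵁ (C b).U) ?_ fun b ↦ ?_⟩
  · rw [TopologicalSpace.IsOpenCover, ← Scheme.Hom.preimage_iSup, hC.iSup_eq_top]
    rfl
  · rw [← Scheme.Hom.comp_appTop_apply, ← morphismRestrict_ι, Scheme.Hom.comp_appTop_apply, hf b,
      ← Scheme.Hom.comp_appTop_apply, ← (C b).smul_coord, hinv]

/-- The map p ↦ (π(p), F(p)) is equivariant; over a chart with section σ its inverse is (b, c) ↦
σ(b)·(c − F(σ(b))). -/
theorem isTrivial_of_hasSlope_one {F : Γ(P.total, ⊤)} (hF : P.action.HasSlope F 1) :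
    P.IsTrivial := by
  let φ : P.total ⟶ 𝔸(PUnit.{u + 1}; B) := AffineSpace.homOfVector P.proj (fun _ ↦ F)
  have hφ : φ ≫ 𝔸(PUnit.{u + 1}; B) ↘ B = P.proj := AffineSpace.homOfVector_over _ _
  have hφc : φ.appTop (AffineSpace.coord B PUnit.unit) = F :=
    AffineSpace.homOfVector_appTop_coord _ _ _
  have hF' {T : Scheme.{u}} (p : T ⟶ P.total) (a) :
      (P.action.smul p a).appTop F = p.appTop F + a := by
    rw [hF, map_one, one_mul]
  have : IsIso φ := by
    refine Scheme.isIso_of_forall_exists_opens φ fun y ↦ ?_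
    obtain ⟨C, hC⟩ := P.exists_chart ((𝔸(PUnit.{u + 1}; B) ↘ B) y)
    let V := (𝔸(PUnit.{u + 1}; B) ↘ B) ⁻¹ᵁ C.U
    let r : (V : Scheme.{u}) ⟶ (C.U : Scheme.{u}) := (𝔸(PUnit.{u + 1}; B) ↘ B) ∣_ C.U
    have hr : r ≫ C.U.ι = V.ι ≫ 𝔸(PUnit.{u + 1}; B) ↘ B := morphismRestrict_ι _ _
    refine ⟨V, hC, P.action.smul (r ≫ C.sec)
      (V.ι.appTop (AffineSpace.coord B PUnit.unit) - (r ≫ C.sec).appTop F), ?_, ?_⟩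
    · apply AffineSpace.hom_ext
      · rw [Category.assoc, hφ, smul_proj, Category.assoc, C.sec_proj, hr]
      · rintro ⟨⟩
        rw [Scheme.Hom.comp_appTop_apply, hφc, hF', add_sub_cancel]
    · intro T p q hpq
      obtain ⟨a, ha⟩ := C.exists_eq_smul p (q ≫ r) (by
        rw [← hφ, ← Category.assoc, hpq, Category.assoc, Category.assoc, hr])
      rw [comp_smul, ← Category.assoc, ha]
      congr 1
      rw [map_sub, ← Scheme.Hom.comp_appTop_apply, ← hpq, Scheme.Hom.comp_appTop_apply, hφc, ha,
        hF', ← Scheme.Hom.comp_appTop_apply, Category.assoc, add_sub_cancel_left]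
  refine ⟨(asIso φ).symm, ?_, ?_⟩
  · change inv φ ≫ _ = _
    rw [← hφ, IsIso.inv_hom_id_assoc]
  · change (translation B).act ≫ inv φ = AffineSpace.map _ (inv φ) ≫ P.action.act
    rw [IsIso.comp_inv_eq, Category.assoc, act_eq_smul, smul_translation]
    apply AffineSpace.hom_ext
    · rw [AffineSpace.homOfVector_over, Category.assoc, Category.assoc, hφ, P.act_proj,
        AffineSpace.map_over_assoc, ← hφ, IsIso.inv_hom_id_assoc]
    · rintro ⟨⟩
      rw [AffineSpace.homOfVector_appTop_coord, Scheme.Hom.comp_appTop_apply,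
        Scheme.Hom.comp_appTop_apply, hφc, hF.act_appTop, map_add, map_one, one_mul,
        AffineSpace.map_appTop_coord, ← Scheme.Hom.comp_appTop_apply, AffineSpace.map_over,
        Scheme.Hom.comp_appTop_apply]
      congr 2
      rw [← hφc, ← Scheme.Hom.comp_appTop_apply, IsIso.inv_hom_id, Scheme.Hom.id_appTop]
      rfl

theorem IsTrivial.exists_section (h : P.IsTrivial) : ∃ σ : B ⟶ P.total, σ ≫ P.proj = 𝟙 B := by
  obtain ⟨e, he, -⟩ := h
  exact ⟨AffineSpace.homOfVector (𝟙 B) (fun _ ↦ 0) ≫ e.hom, by simp [he]⟩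

theorem proj_of_isZariskiLocalAtTarget (W : MorphismProperty Scheme.{u}) [IsZariskiLocalAtTarget W]
    (hW : ∀ S : Scheme.{u}, W (𝔸(PUnit.{u + 1}; S) ↘ S)) : W P.proj := by
  refine IsZariskiLocalAtTarget.of_forall_exists_morphismRestrict fun b ↦ ?_
  obtain ⟨U, hb, e, he, -⟩ := P.locally_trivial b
  refine ⟨U, hb, ?_⟩
  rw [← W.cancel_left_of_respectsIso e.hom, he]
  exact hW _

variable (P) in
theorem isAffineHom_proj : IsAffineHom P.proj :=
  have : IsZariskiLocalAtTarget @IsAffineHom.{u} :=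
    @HasAffineProperty.instIsZariskiLocalAtTarget _ _ instHasAffinePropertyIsAffineHomIsAffine
  proj_of_isZariskiLocalAtTarget @IsAffineHom fun _ ↦ inferInstance

variable (P) in
theorem flat_proj : Flat P.proj :=
  have : IsZariskiLocalAtTarget @Flat.{u} := HasRingHomProperty.instIsZariskiLocalAtTarget _
  proj_of_isZariskiLocalAtTarget @Flat fun S ↦ AffineSpace.flat_over _ S

end PrincipalGaBundle

/-! ### Hartogs extension on open subschemes -/

namespace AlgebraicGeometry

variable {R : Type u} [CommRing R] [IsDomain R]

theorem Scheme.scalar_pow_mul_eq_zero {X : Scheme.{u}}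
    (q : X ⟶ Spec (CommRingCat.of R)) [Flat q] {r : R} (hr : r ≠ 0) (n : ℕ) {s : Γ(X, ⊤)}
    (h : Scheme.scalar q r ^ n * s = 0) : s = 0 := by
  rw [← map_pow] at h
  exact Scheme.scalar_mul_eq_zero q (pow_ne_zero n hr) h

theorem Scheme.scalar_injective {X : Scheme.{u}} [Nonempty X]
    (q : X ⟶ Spec (CommRingCat.of R)) [Flat q] : Function.Injective (Scheme.scalar q) := by
  rw [injective_iff_map_eq_zero]
  intro r hr
  by_contra h
  have : Nonempty (⊤ : X.Opens) := ⟨⟨Classical.arbitrary X, trivial⟩⟩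
  have : Nontrivial Γ(X, ⊤) := Scheme.component_nontrivial X ⊤
  exact one_ne_zero (Scheme.scalar_mul_eq_zero q h (s := 1) (by rw [hr, zero_mul]))

/-- A regular function on an open subset of a normal noetherian affine scheme extends over a
closed point of codimension at least two. -/
theorem Scheme.exists_eq_scalar_of_two_le_height [IsNoetherianRing R] [IsIntegrallyClosed R]
    (B : (Spec (CommRingCat.of R)).Opens) (m : Ideal R) (hm : m.IsMaximal) (hht : 2 ≤ m.height)
    (hB : ∀ a ∈ m, (Spec (CommRingCat.of R)).basicOpen
      (Scheme.scalar (𝟙 (Spec (CommRingCat.of R))) a) ≤ B)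
    (f : Γ((B : Scheme.{u}), ⊤)) : ∃ r, f = Scheme.scalar B.ι r := by
  have hm0 : m ≠ ⊥ := by
    rintro rfl
    simp at hht
  obtain ⟨b, hb, hb0⟩ := Submodule.exists_mem_ne_zero_of_ne_bot hm0
  have : Nonempty B := by
    let y : Spec (CommRingCat.of R) := ⟨⊥, Ideal.isPrime_bot⟩
    exact ⟨y, hB b hb ((Scheme.mem_basicOpen_scalar_iff (𝟙 _) b y).2 hb0)⟩
  have : IsIntegral (B : Scheme.{u}) := inferInstance
  have : CompactSpace (B : Scheme.{u}) := QuasiCompact.compactSpace_of_compactSpace B.ι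
  let := (Scheme.scalar B.ι).toAlgebra
  refine IsIntegrallyClosed.mem_range_of_forall_pow_mul_mem_range (Scheme.scalar_injective B.ι) m hm
    hht f fun a ha ↦ ?_
  by_cases ha0 : a = 0
  · exact ⟨1, 0, by rw [ha0, map_zero, pow_one, zero_mul]⟩
  change ∃ n : ℕ, ∃ r, Scheme.scalar B.ι a ^ n * f = Scheme.scalar B.ι r
  let S := Spec (CommRingCat.of R)
  let s := Scheme.scalar (𝟙 S) a
  let j : (S.basicOpen s : Scheme.{u}) ⟶ (B : Scheme.{u}) := S.homOfLE (hB a ha)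
  have hj : j ≫ B.ι = (S.basicOpen s).ι := S.homOfLE_ι (hB a ha)
  -- On D(a), `a ^ n * f` comes from R. Equality on all of `B` then holds up to a power of a, which
  -- flatness cancels.
  obtain ⟨n, t, ht⟩ := Scheme.exists_appTop_basicOpen_ι_eq_pow_mul s (j.appTop f)
  obtain ⟨r, rfl⟩ : ∃ r, t = Scheme.scalar (𝟙 S) r :=
    ⟨(Scheme.ΓSpecIso _).hom t, by
      rw [Scheme.scalar, Scheme.Hom.id_appTop, Category.comp_id]
      exact (Iso.hom_inv_id_apply (Scheme.ΓSpecIso _) t).symm⟩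
  refine ⟨n, r, ?_⟩
  let W := (B : Scheme.{u}).basicOpen (Scheme.scalar B.ι a)
  let k : (W : Scheme.{u}) ⟶ (S.basicOpen s : Scheme.{u}) :=
    IsOpenImmersion.lift (S.basicOpen s).ι (W.ι ≫ B.ι) (by
      rw [Scheme.Opens.range_ι]
      rintro _ ⟨z, rfl⟩
      exact (Scheme.mem_basicOpen_scalar_iff (𝟙 S) a _).2
        ((Scheme.mem_basicOpen_scalar_iff B.ι a z.1).1 z.2))
  have hk : k ≫ (S.basicOpen s).ι = W.ι ≫ B.ι := IsOpenImmersion.lift_fac _ _ _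
  have hkj : k ≫ j = W.ι := by rw [← cancel_mono B.ι, Category.assoc, hj, hk]
  have hW (r : R) : k.appTop ((S.basicOpen s).ι.appTop (Scheme.scalar (𝟙 S) r)) =
      W.ι.appTop (Scheme.scalar B.ι r) := by
    rw [← Scheme.Hom.comp_appTop_apply, hk, ← Scheme.scalar_comp, ← Scheme.scalar_comp,
      Category.comp_id]
  obtain ⟨l, hl⟩ := Scheme.exists_pow_mul_eq_zero_of_appTop_basicOpen_ι_eq_zero
    (Scheme.scalar B.ι a) (Scheme.scalar B.ι a ^ n * f - Scheme.scalar B.ι r) (by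
      have hpow := map_pow W.ι.appTop.hom (Scheme.scalar B.ι a) n
      have hpow' := map_pow k.appTop.hom ((S.basicOpen s).ι.appTop s) n
      have h1 := congr(k.appTop $ht)
      rw [map_mul, hpow', ← Scheme.Hom.comp_appTop_apply k j, hkj, hW, hW] at h1
      refine (map_sub _ _ _).trans (sub_eq_zero.2 ?_)
      rw [h1, map_mul, hpow])
  exact sub_eq_zero.1 (Scheme.scalar_pow_mul_eq_zero B.ι ha0 l hl)

end AlgebraicGeometry

/-! ### The ideal of slopes -/

namespace PrincipalGaBundle

open GaAction

variable {R : Type u} [CommRing R] {B : Scheme.{u}} (P : PrincipalGaBundle B)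
  (q : B ⟶ Spec (CommRingCat.of R))

theorem hasSlope_scalar (r : R) : P.action.HasSlope (Scheme.scalar (P.proj ≫ q) r) 0 := by
  rw [Scheme.scalar_comp]
  exact P.hasSlope_proj_appTop _

/-- The ideal of the slopes of the functions on the total space. -/
noncomputable def slopeIdeal : Ideal R where
  carrier := {r | ∃ F, P.action.HasSlope F (Scheme.scalar (P.proj ≫ q) r)}
  zero_mem' := ⟨0, by
    rw [map_zero]
    intro T p a
    simp only [map_zero, zero_mul, add_zero]⟩
  add_mem' := by
    rintro a b ⟨F, hF⟩ ⟨G, hG⟩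
    exact ⟨F + G, by rw [map_add]; exact hF.add hG⟩
  smul_mem' := by
    rintro c a ⟨F, hF⟩
    exact ⟨Scheme.scalar (P.proj ≫ q) c * F, by
      rw [smul_eq_mul, map_mul]; exact (P.hasSlope_scalar q c).mul hF⟩

theorem isTrivial_of_slopeIdeal_eq_top (h : P.slopeIdeal q = ⊤) : P.IsTrivial := by
  obtain ⟨F, hF⟩ : (1 : R) ∈ P.slopeIdeal q := h ▸ Submodule.mem_top
  rw [map_one] at hF
  exact isTrivial_of_hasSlope_one hF

variable {P q} in
/-- Slopes can be computed after multiplication by a nonzero scalar. -/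
theorem hasSlope_of_scalar_mul [IsDomain R] [Flat q] {g : R} (hg : g ≠ 0) {F : Γ(P.total, ⊤)} {r : R}
    (h : P.action.HasSlope (Scheme.scalar (P.proj ≫ q) g * F) (Scheme.scalar (P.proj ≫ q) (g * r))) :
    P.action.HasSlope F (Scheme.scalar (P.proj ≫ q) r) := by
  refine hasSlope_of_act _ (sub_eq_zero.1 ?_)
  have := P.flat_proj
  have := AffineSpace.flat_over PUnit.{u + 1} P.total
  refine Scheme.scalar_mul_eq_zero
    ((𝔸(PUnit.{u + 1}; P.total) ↘ P.total) ≫ P.proj ≫ q) hg ?_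
  have h1 := h.act_appTop
  have h2 := (P.hasSlope_scalar q g).act_appTop
  rw [map_zero, zero_mul, add_zero] at h2
  rw [map_mul, h2, map_mul, map_mul,
    map_mul] at h1
  rw [Scheme.scalar_comp, mul_sub, h1]
  ring

/-- Over D(g) the chart coordinate has slope 1, and some gⁿ times it extends to P. The slope
identity holds on D(g) in P × G_a, hence up to a power of g, hence everywhere by flatness. -/
theorem exists_mem_slopeIdeal [IsDomain R] [CompactSpace P.total] [QuasiSeparatedSpace P.total]
    [Flat q] (C : P.Chart) {g : R} (hg : g ≠ 0) (hC : B.basicOpen (Scheme.scalar q g) ≤ C.U) :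
    ∃ n : ℕ, g ^ n ∈ P.slopeIdeal q := by
  have := P.flat_proj
  have := AffineSpace.flat_over PUnit.{u + 1} P.total
  set ρ := Scheme.scalar (P.proj ≫ q) with hρ
  let Z := P.total.basicOpen (ρ g)
  have hZ : Z ≤ P.proj ⁻¹ᵁ C.U := by
    intro z hz
    refine hC ?_
    rw [Scheme.mem_basicOpen_scalar_iff] at hz ⊢
    exact hz
  let i := P.total.homOfLE hZ
  have hi : i ≫ (P.proj ⁻¹ᵁ C.U).ι = Z.ι := Scheme.homOfLE_ι _ _
  obtain ⟨n, F, hF⟩ := Scheme.exists_appTop_basicOpen_ι_eq_pow_mul (ρ g) (i.appTop C.coord)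
  refine ⟨n, F, hasSlope_of_act _ (sub_eq_zero.1 ?_)⟩
  let A := 𝔸(PUnit.{u + 1}; P.total)
  let pr : A ⟶ P.total := A ↘ P.total
  have : CompactSpace A := QuasiCompact.compactSpace_of_compactSpace pr
  let W := A.basicOpen (Scheme.scalar (pr ≫ P.proj ≫ q) g)
  have hlift (f : A ⟶ P.total) (hf : f ≫ P.proj = pr ≫ P.proj) :
      ∃ p : (W : Scheme.{u}) ⟶ Z, p ≫ Z.ι = W.ι ≫ f := by
    refine ⟨IsOpenImmersion.lift Z.ι (W.ι ≫ f) ?_, IsOpenImmersion.lift_fac _ _ _⟩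
    rw [Scheme.Opens.range_ι]
    rintro _ ⟨z, rfl⟩
    change (W.ι ≫ f) z ∈ P.total.basicOpen (ρ g)
    have hz := (Scheme.mem_basicOpen_scalar_iff (pr ≫ P.proj ≫ q) g z.1).1 z.2
    rw [hρ, Scheme.mem_basicOpen_scalar_iff, ← Scheme.Hom.comp_apply, Category.assoc,
      ← Category.assoc f, hf]
    exact hz
  obtain ⟨p₁, h₁⟩ := hlift pr rfl
  obtain ⟨p₂, h₂⟩ := hlift P.action.act P.act_proj
  have hc : (p₂ ≫ i).appTop C.coord = (p₁ ≫ i).appTop C.coord +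
      W.ι.appTop (AffineSpace.coord P.total PUnit.unit) := by
    refine C.appTop_coord_of_eq_smul (p₁ ≫ i) (p₂ ≫ i) _ ?_
    rw [Category.assoc, hi, h₂, Category.assoc, hi, h₁, act_eq_smul, comp_smul]
  have hs₁ : p₁.appTop (Z.ι.appTop (ρ g)) = W.ι.appTop (pr.appTop (ρ g)) := by
    rw [← Scheme.Hom.comp_appTop_apply, h₁, Scheme.Hom.comp_appTop_apply]
  have hs₂ : p₂.appTop (Z.ι.appTop (ρ g)) = W.ι.appTop (pr.appTop (ρ g)) := by
    rw [← Scheme.Hom.comp_appTop_apply, h₂, hρ, ← Scheme.scalar_comp, ← Scheme.scalar_comp,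
      ← Scheme.scalar_comp, Category.assoc, ← Category.assoc P.action.act, P.act_proj]
    rfl
  have e₁ : W.ι.appTop (pr.appTop F) =
      W.ι.appTop (pr.appTop (ρ g)) ^ n * (p₁ ≫ i).appTop C.coord := by
    rw [← Scheme.Hom.comp_appTop_apply W.ι, ← h₁, Scheme.Hom.comp_appTop_apply p₁, hF, map_mul,
      map_pow, hs₁, Scheme.Hom.comp_appTop_apply p₁]
  have e₂ : W.ι.appTop (P.action.act.appTop F) =
      W.ι.appTop (pr.appTop (ρ g)) ^ n * (p₂ ≫ i).appTop C.coord := by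
    rw [← Scheme.Hom.comp_appTop_apply W.ι, ← h₂, Scheme.Hom.comp_appTop_apply p₂, hF, map_mul,
      map_pow, hs₂, Scheme.Hom.comp_appTop_apply p₂]
  obtain ⟨l, hl⟩ := Scheme.exists_pow_mul_eq_zero_of_appTop_basicOpen_ι_eq_zero
    (Scheme.scalar (pr ≫ P.proj ≫ q) g) (P.action.act.appTop F - (pr.appTop F +
      pr.appTop (ρ (g ^ n)) * AffineSpace.coord P.total PUnit.unit)) (by
      have hpow := map_pow (W.ι.appTop.hom.comp (pr.appTop.hom.comp ρ)) g n
      change W.ι.appTop (pr.appTop (ρ (g ^ n))) = W.ι.appTop (pr.appTop (ρ g)) ^ n at hpow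
      refine (map_sub _ _ _).trans (sub_eq_zero.2 ?_)
      rw [map_add, map_mul, e₁, e₂, hc, hpow]
      exact mul_add _ _ _)
  exact Scheme.scalar_pow_mul_eq_zero (pr ≫ P.proj ≫ q) hg l hl

end PrincipalGaBundle

namespace AlgebraicGeometry

theorem Scheme.isUnit_appTop_basicOpen_ι {X : Scheme.{u}} (s : Γ(X, ⊤)) :
    IsUnit ((X.basicOpen s).ι.appTop s) := by
  have h := RingedSpace.isUnit_res_basicOpen X.toRingedSpace s
  refine (isUnit_map_iff (X.basicOpen s).topIso.hom.hom _).1 ?_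
  change IsUnit ((X.basicOpen s).topIso.hom ((X.basicOpen s).ι.appTop s))
  rw [← CommRingCat.comp_apply, Scheme.Opens.ι_appTop_topIso_hom]
  exact h

/-- Compatible fractions `N i / d i`, where the `d i` generate the unit ideal locally, glue to a
function. -/
theorem Scheme.exists_forall_mul_eq {X : Scheme.{u}} {ι : Type u} {d N : ι → Γ(X, ⊤)}
    (hd : TopologicalSpace.IsOpenCover fun i ↦ X.basicOpen (d i))
    (h : ∀ i j, d j * N i = d i * N j) : ∃ t, ∀ i, d i * t = N i := by
  have hG (i : ι) : ∃ G, (X.basicOpen (d i)).ι.appTop (d i) * G =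
      (X.basicOpen (d i)).ι.appTop (N i) :=
    (Scheme.isUnit_appTop_basicOpen_ι (d i)).dvd.imp fun _ h ↦ h.symm
  choose G hG using hG
  have hT (i : ι) {T : Scheme.{u}} (f : T ⟶ (X.basicOpen (d i) : Scheme.{u})) :
      IsUnit ((f ≫ (X.basicOpen (d i)).ι).appTop (d i)) ∧
        (f ≫ (X.basicOpen (d i)).ι).appTop (d i) * f.appTop (G i) =
          (f ≫ (X.basicOpen (d i)).ι).appTop (N i) := by
    rw [Scheme.Hom.comp_appTop_apply, Scheme.Hom.comp_appTop_apply]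
    refine ⟨(Scheme.isUnit_appTop_basicOpen_ι (d i)).map f.appTop.hom, ?_⟩
    rw [← hG, map_mul]
  obtain ⟨t, ht⟩ := Scheme.exists_appTop_eq hd G (by
    intro i j T f g hfg
    obtain ⟨hu₁, h₁⟩ := hT i f
    obtain ⟨hu₂, h₂⟩ := hT j g
    rw [← hfg] at hu₂ h₂
    have h₃ := congr((f ≫ (X.basicOpen (d i)).ι).appTop $(h i j))
    rw [map_mul, map_mul, ← h₁, ← h₂, mul_left_comm] at h₃
    exact hu₂.mul_left_cancel (hu₁.mul_left_cancel h₃))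
  refine ⟨t, fun i ↦ Scheme.appTop_ext hd fun j ↦ ?_⟩
  refine (Scheme.isUnit_appTop_basicOpen_ι (d j)).mul_left_cancel ?_
  rw [map_mul, ht, mul_left_comm, hG, ← map_mul, ← map_mul, h]

end AlgebraicGeometry

/-! ### Bundles on the punctured spectrum: affineness criterion and conclusion -/

namespace PrincipalGaBundle

open GaAction

variable {R : Type u} [CommRing R] {x : PrimeSpectrum R}
  {hx : IsClosed ({x} : Set (PrimeSpectrum R))}
  (P : PrincipalGaBundle (puncturedSpec R x hx : Scheme.{u}))

/-- The pullback of functions from `Spec R` to the total space. -/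
noncomputable def scalar : R →+* Γ(P.total, ⊤) :=
  Scheme.scalar (P.proj ≫ (puncturedSpec R x hx).ι)

theorem exists_mem_basicOpen_scalar (z : P.total) :
    ∃ a ∈ x.asIdeal, z ∈ P.total.basicOpen (P.scalar a) := by
  have hm : x.asIdeal.IsMaximal := (PrimeSpectrum.isClosed_singleton_iff_isMaximal x).1 hx
  have hy : (P.proj z).1 ≠ x := (P.proj z).2
  by_contra! h
  refine hy (PrimeSpectrum.ext (hm.eq_of_le (PrimeSpectrum.isPrime _).ne_top fun a ha ↦ ?_).symm)
  have h1 := h a ha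
  rw [scalar, Scheme.mem_basicOpen_scalar_iff, not_not] at h1
  exact h1

theorem isOpenCover_basicOpen_scalar : TopologicalSpace.IsOpenCover
    fun a : x.asIdeal ↦ P.total.basicOpen (P.scalar a.1) := by
  refine eq_top_iff.2 fun z _ ↦ TopologicalSpace.Opens.mem_iSup.2 ?_
  obtain ⟨a, ha, hz⟩ := P.exists_mem_basicOpen_scalar z
  exact ⟨⟨a, ha⟩, hz⟩

theorem isAffineOpen_basicOpen_scalar {a : R} (ha : a ∈ x.asIdeal) :
    IsAffineOpen (P.total.basicOpen (P.scalar a)) := by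
  have := P.isAffineHom_proj
  let B := puncturedSpec R x hx
  have h1 : IsAffineOpen ((B : Scheme.{u}).basicOpen (Scheme.scalar B.ι a)) := by
    rw [← Scheme.Hom.isAffineOpen_iff_of_isOpenImmersion B.ι]
    have h2 : B.ι ''ᵁ ((B : Scheme.{u}).basicOpen (Scheme.scalar B.ι a)) =
        (Spec (CommRingCat.of R)).basicOpen (Scheme.scalar (𝟙 (Spec (CommRingCat.of R))) a) := by
      ext y
      constructor
      · rintro ⟨z, hz, rfl⟩
        exact (Scheme.mem_basicOpen_scalar_iff (𝟙 _) a _).2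
          ((Scheme.mem_basicOpen_scalar_iff B.ι a z).1 hz)
      · intro hy
        have hy' := (Scheme.mem_basicOpen_scalar_iff (𝟙 _) a y).1 hy
        refine ⟨⟨y, fun h ↦ hy' ?_⟩, (Scheme.mem_basicOpen_scalar_iff B.ι a _).2 hy', rfl⟩
        obtain rfl : y = x := h
        exact ha
    rw [h2]
    exact (isAffineOpen_top _).basicOpen _
  rw [scalar, Scheme.scalar_comp, ← Scheme.preimage_basicOpen_top]
  exact h1.preimage P.proj

theorem isAffine_of_span_scalar_eq_top (h : Ideal.span (P.scalar '' x.asIdeal) = ⊤) :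
    IsAffine P.total := by
  refine isAffine_of_isAffineOpen_basicOpen _ h ?_
  rintro _ ⟨a, ha, rfl⟩
  exact P.isAffineOpen_basicOpen_scalar ha

theorem span_scalar_eq_top [IsAffine P.total] : Ideal.span (P.scalar '' x.asIdeal) = ⊤ := by
  rw [← (isAffineOpen_top P.total).self_le_iSup_basicOpen_iff]
  intro z _
  obtain ⟨a, ha, hz⟩ := P.exists_mem_basicOpen_scalar z
  exact TopologicalSpace.Opens.mem_iSup.2 ⟨⟨_, a, ha, rfl⟩, hz⟩

variable [IsDomain R]

theorem scalar_mul_eq_zero {r : R} (hr : r ≠ 0) {F : Γ(P.total, ⊤)} (h : P.scalar r * F = 0) :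
    F = 0 := by
  have := P.flat_proj
  exact Scheme.scalar_mul_eq_zero _ hr h

/-- Division of functions on the total space: if `v X = u Y` then `s X` is divisible by `u`,
whenever `s` maps the ideal of the point into `(u, v)`. -/
theorem exists_scalar_mul_eq {u v s : R} (hu : u ≠ 0) (hum : u ∈ x.asIdeal)
    (h : ∀ a ∈ x.asIdeal, ∃ p q, s * a = p * u + q * v) {X Y : Γ(P.total, ⊤)}
    (hXY : P.scalar v * X = P.scalar u * Y) :
    ∃ G, P.scalar u * G = P.scalar s * X := by
  choose! p q hpq using h
  -- As `vX = uY`, this is `s a X / u` written without denominators; the quotients `N a / a` glue to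
  -- `s X / u`.
  let N (a : R) : Γ(P.total, ⊤) := P.scalar (p a) * X + P.scalar (q a) * Y
  have hN (a : R) (ha : a ∈ x.asIdeal) : P.scalar u * N a = P.scalar a * (P.scalar s * X) := by
    have h1 := congr(P.scalar $(hpq a ha))
    simp only [map_mul, map_add] at h1
    linear_combination (-P.scalar (q a)) * hXY - X * h1
  have hNN (a b : R) (ha : a ∈ x.asIdeal) (hb : b ∈ x.asIdeal) :
      P.scalar b * N a = P.scalar a * N b := by
    rw [← sub_eq_zero]
    refine P.scalar_mul_eq_zero hu ?_
    linear_combination P.scalar b * hN a ha - P.scalar a * hN b hb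
  obtain ⟨t, ht⟩ := Scheme.exists_forall_mul_eq (N := fun a : x.asIdeal ↦ N a.1)
    P.isOpenCover_basicOpen_scalar fun a b ↦ hNN a b a.2 b.2
  refine ⟨t, sub_eq_zero.1 (P.scalar_mul_eq_zero hu ?_)⟩
  have htu : P.scalar u * t = N u := ht ⟨u, hum⟩
  rw [htu, mul_sub, hN u hum, sub_self]

variable [IsNoetherianRing R]

/-- A prime not containing m is a point of S_*; a basic neighbourhood D(g) inside a chart gives a
power of g in the slope ideal but not in p. -/
theorem le_of_slopeIdeal_le (p : Ideal R) (hp : p.IsPrime)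
    (h : P.slopeIdeal (puncturedSpec R x hx).ι ≤ p) : x.asIdeal ≤ p := by
  let B := puncturedSpec R x hx
  have := P.isAffineHom_proj
  have : CompactSpace (B : Scheme.{u}) := QuasiCompact.compactSpace_of_compactSpace B.ι
  have : CompactSpace P.total := QuasiCompact.compactSpace_of_compactSpace P.proj
  have : QuasiSeparatedSpace (B : Scheme.{u}) := quasiSeparatedSpace_of_quasiSeparated B.ι
  have : QuasiSeparatedSpace P.total := quasiSeparatedSpace_of_quasiSeparated P.proj
  by_contra hxp
  let y : (B : Scheme.{u}) := ⟨⟨p, hp⟩, by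
    rintro rfl
    exact hxp le_rfl⟩
  obtain ⟨C, hC⟩ := P.exists_chart y
  obtain ⟨_, ⟨_, ⟨g, rfl⟩, rfl⟩, hgy, hgC⟩ :=
    PrimeSpectrum.isBasis_basic_opens.exists_subset_of_mem_open
      (show (⟨p, hp⟩ : PrimeSpectrum R) ∈ (B.ι ''ᵁ C.U).carrier from ⟨y, hC, rfl⟩)
      (B.ι ''ᵁ C.U).2
  have hgp : g ∉ p := hgy
  obtain ⟨n, hn⟩ := P.exists_mem_slopeIdeal B.ι C (g := g) (fun h ↦ hgp (h ▸ p.zero_mem)) (by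
    intro z hz
    obtain ⟨z', hz', h⟩ := hgC ((Scheme.mem_basicOpen_scalar_iff B.ι g z).1 hz)
    obtain rfl : z' = z := Subtype.ext h
    exact hz')
  exact hgp (hp.mem_of_pow_mem n (h hn))

variable [IsIntegrallyClosed R]

theorem exists_eq_scalar (hht : 2 ≤ x.asIdeal.height)
    (f : Γ((puncturedSpec R x hx : Scheme.{u}), ⊤)) :
    ∃ r, f = Scheme.scalar (puncturedSpec R x hx).ι r :=
  Scheme.exists_eq_scalar_of_two_le_height (puncturedSpec R x hx) _
    ((PrimeSpectrum.isClosed_singleton_iff_isMaximal x).1 hx)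
    hht (fun a ha y hy (h : y = x) ↦ (Scheme.mem_basicOpen_scalar_iff (𝟙 _) a y).1 hy (by
      rw [h]
      exact ha)) f

theorem not_isTrivial_of_isAffine (hht : 2 ≤ x.asIdeal.height) [IsAffine P.total] :
    ¬ P.IsTrivial := by
  intro h
  obtain ⟨σ, hσ⟩ := h.exists_section
  let B := puncturedSpec R x hx
  have hm : x.asIdeal.IsMaximal := (PrimeSpectrum.isClosed_singleton_iff_isMaximal x).1 hx
  have h1 : (1 : Γ(P.total, ⊤)) ∈ x.asIdeal.map P.scalar := by
    rw [Ideal.map, P.span_scalar_eq_top]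
    trivial
  have h2 := Ideal.mem_map_of_mem σ.appTop.hom h1
  have hcomp : σ.appTop.hom.comp P.scalar = Scheme.scalar B.ι := by
    ext r
    change σ.appTop (Scheme.scalar _ r) = _
    rw [← Scheme.scalar_comp, ← Category.assoc, hσ, Category.id_comp]
  rw [Ideal.map_map, hcomp, map_one] at h2
  obtain ⟨a, ha, h3⟩ := (Ideal.mem_map_iff_of_surjective (Scheme.scalar B.ι) fun f ↦ by
    obtain ⟨r, hr⟩ := exists_eq_scalar hht f
    exact ⟨r, hr.symm⟩).1 h2
  have : Nonempty (B : Scheme.{u}) := by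
    refine ⟨⟨⟨⊥, Ideal.isPrime_bot⟩, ?_⟩⟩
    rintro rfl
    simp at hht
  have : a = 1 := Scheme.scalar_injective B.ι (by rw [h3, map_one])
  exact hm.ne_top ((Ideal.eq_top_iff_one _).2 (this ▸ ha))

theorem isAffine_of_not_isTrivial (hht : x.asIdeal.height = 2)
    (hreg : IsRegularLocalRing (Localization.AtPrime x.asIdeal)) (h : ¬ P.IsTrivial) :
    IsAffine P.total := by
  have hm : x.asIdeal.IsMaximal := (PrimeSpectrum.isClosed_singleton_iff_isMaximal x).1 hx
  obtain ⟨r, hr, hmr⟩ := Ideal.exists_notMem_forall_mul_mem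
    (fun hJ ↦ h (P.isTrivial_of_slopeIdeal_eq_top _ hJ)) P.le_of_slopeIdeal_le
  obtain ⟨u, hu, hu0, v, hv, s, hs, hsm⟩ := x.asIdeal.exists_span_pair_of_regular hreg hht
  obtain ⟨f, hf⟩ := hmr u hu
  obtain ⟨g, hg⟩ := hmr v hv
  change P.action.HasSlope f (P.scalar (u * r)) at hf
  change P.action.HasSlope g (P.scalar (v * r)) at hg
  have hc (c : R) : P.action.HasSlope (P.scalar c) 0 := P.hasSlope_scalar _ c
  have hw : P.action.HasSlope (P.scalar v * f - P.scalar u * g) 0 := by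
    have h1 := ((hc v).mul hf).sub ((hc u).mul hg)
    have h2 : P.scalar v * P.scalar (u * r) - P.scalar u * P.scalar (v * r) = 0 := by
      rw [map_mul, map_mul]
      ring
    rwa [h2] at h1
  obtain ⟨w, hw⟩ : ∃ w, P.scalar v * f - P.scalar u * g = P.scalar w := by
    obtain ⟨w₀, hw₀⟩ := exists_proj_appTop_eq hw
    obtain ⟨w, rfl⟩ := exists_eq_scalar hht.ge w₀
    exact ⟨w, by rw [← hw₀, scalar, Scheme.scalar_comp]⟩
  have hone (b : R) (hb : b ∉ x.asIdeal) : ∃ c, ∃ a ∈ x.asIdeal, c * b + a = 1 := by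
    obtain ⟨c, hc⟩ := hm.exists_inv hb
    exact ⟨c, hc⟩
  by_cases hwm : w ∈ x.asIdeal
  · exfalso
    obtain ⟨α, β, hαβ⟩ := hsm w hwm
    have hαβ' := congr(P.scalar $hαβ)
    simp only [map_mul, map_add] at hαβ'
    obtain ⟨G, hG⟩ := P.exists_scalar_mul_eq hu0 hu hsm
      (X := P.scalar s * f - P.scalar β) (Y := P.scalar s * g + P.scalar α) (by
        linear_combination P.scalar s * hw + hαβ')
    have hGs : P.action.HasSlope G (P.scalar (s * s * r)) := by
      refine hasSlope_of_scalar_mul hu0 ?_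
      change P.action.HasSlope (P.scalar u * G) (P.scalar _)
      rw [hG]
      have h1 := (hc s).mul (((hc s).mul hf).sub (hc β))
      have h2 : P.scalar (u * (s * s * r)) =
          P.scalar s * (P.scalar s * P.scalar (u * r) - 0) := by
        simp only [map_mul]
        ring
      rwa [h2]
    -- With `c s² + a = 1`, r splits as `c (s² r) + a r`: the first term is a multiple of the slope
    -- of `G`, the second lies in `m r`.
    obtain ⟨c, a, ha, h1⟩ := hone (s * s) fun h ↦ (hm.isPrime.mem_or_mem h).elim hs hs
    apply hr
    have h2 : r = c * (s * s * r) + a * r := by linear_combination -r * h1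
    rw [h2]
    exact Ideal.add_mem _ (Ideal.mul_mem_left _ _ ⟨G, hGs⟩) (hmr a ha)
  · refine P.isAffine_of_span_scalar_eq_top ((Ideal.eq_top_iff_one _).2 ?_)
    obtain ⟨c, a, ha, h1⟩ := hone w hwm
    have h2 : (1 : Γ(P.total, ⊤)) = P.scalar c * f * P.scalar v - P.scalar c * g * P.scalar u +
        P.scalar a := by
      have h3 := congr(P.scalar $h1)
      simp only [map_mul, map_add, map_one] at h3
      linear_combination -h3 - P.scalar c * hw
    rw [h2]
    have hmem (b : R) (hb : b ∈ x.asIdeal) : P.scalar b ∈ Ideal.span (P.scalar '' x.asIdeal) :=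
      Ideal.subset_span ⟨b, hb, rfl⟩
    exact Ideal.add_mem _ (Ideal.sub_mem _ (Ideal.mul_mem_left _ _ (hmem v hv))
      (Ideal.mul_mem_left _ _ (hmem u hu))) (hmem a ha)

end PrincipalGaBundle

theorem corollary3p3 (R : Type u) [CommRing R] [IsDomain R] [Algebra ℂ R]
    [Algebra.FiniteType ℂ R] [IsIntegrallyClosed R] (hdim : ringKrullDim R = 2)
    (x : PrimeSpectrum R) (hx : IsClosed ({x} : Set (PrimeSpectrum R)))
    (hreg : IsRegularLocalRing (Localization.AtPrime x.asIdeal))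
    (P : PrincipalGaBundle (puncturedSpec R x hx : Scheme.{u})) :
    IsAffine P.total ↔ ¬ P.IsTrivial := by
  have := Algebra.FiniteType.isNoetherianRing ℂ R
  have hm : x.asIdeal.IsMaximal := (PrimeSpectrum.isClosed_singleton_iff_isMaximal x).1 hx
  have hht : x.asIdeal.height = 2 := by
    have h1 := Ideal.height_le_ringKrullDim_of_ne_top hm.ne_top
    have h2 := x.asIdeal.ringKrullDim_le_height_of_isMaximal ℂ
    rw [hdim] at h1 h2
    exact le_antisymm (WithBot.coe_le_coe.1 h1) (WithBot.coe_le_coe.1 h2)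
  exact ⟨fun _ ↦ P.not_isTrivial_of_isAffine hht.ge, P.isAffine_of_not_isTrivial hht hreg⟩
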